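/- Let $H$ be a separable real Hilbert space and let $\rho$ be a Borel probability measure on the unit sphere $S_H=\{\omega\in H:\|\omega\|=1\}$. Let $Lv=\int_{S_H}(v,\omega)\,\omega\,d\rho(\omega)$, $v\in H$, be the covariance operator, put $\tilde H=H\ominus\mathrm{Ker}(L)$, and let $\{\psi_k\}$ be any complete orthonormal system of $\tilde H$ consisting of eigenvectors of $L$, with eigenvalues $\mu_k>0$ (such a system exists). Define $$H_L^{1/2}=L^{1/2}(H)=\Big\{v=\sum_k\mu_k^{1/2}c_k\psi_k:\ \|v\|_{H_L^{1/2}}:=\Big(\sum_k c_k^2\Big)^{1/2}<\infty\Big\}.$$ Let $A_2$ be the set of all $u\in H$ of the form $u=\int_{S_H}v_\omega\,d\rho(\omega)$ with a Bochner-measurable $\omega\mapsto v_\omega\in\mathrm{span}\{\omega\}$ such that $\int_{S_H}\|v_\omega\|^2\,d\rho<\infty$, and let $\|u\|_{A_2}$ be the infimum of $(\int_{S_H}\|v_\omega\|^2\,d\rho)^{1/2}$ over all such representations of $u$. For $u\in H$ and independent samples $\omega_0,\omega_1,\dots$ from $S_H$ with distribution $\rho$, let $u^{(0)}=0$ and $$u^{(m+1)}=\alpha_m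 u^{(m)}+\xi_m r^{(m)},\qquad r^{(m)}=(u-u^{(m)},\omega_m)\,\omega_m,\qquad \alpha_m=1-\frac1{m+2},\qquad m=0,1,\dots,$$ where $\xi_m\in\mathbb R$ minimizes $\|u-\alpha_mu^{(m)}-\xi\, r^{(m)}\|$ over $\xi$. Put $\delta_m^2=\|u-u^{(m)}\|^2$, which is an integrable random variable. Then: 1. For every $u\in H_L^{1/2}$ and $m=0,1,\dots$, $$\mathbb E(\delta_m^2)\le\frac{\|u\|_{H_L^{1/2}}^2}{m+1}.$$ 2. For every $u\in H$, every $h\in H_L^{1/2}$ and $m=0,1,\dots$, $$\mathbb E(\delta_m^2)^{1/2}\le 2\left(\|u-h\|+\frac{\big(\|h\|_{H_L^{1/2}}^2+\|u\|^2\big)^{1/2}}{(m+1)^{1/2}}\right).$$ 3. For every $u\in\tilde H$, $\mathbb E(\delta_m^2)\to0$ as $m\to\infty$. 4. $A_2=H_L^{1/2}$, and $\|u\|_{A_2}=\|u\|_{H_L^{1/2}}$ for every $u\in H_L^{1/2}$. -/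

import Mathlib

open MeasureTheory ProbabilityTheory Metric Filter Topology TopologicalSpace
open scoped RealInnerProductSpace

namespace RandomSubspace

section

variable {H : Type*} [NormedAddCommGroup H] [InnerProductSpace ℝ H]

/-! ### The randomized incremental iteration -/

/-- The damping factor `α_m = 1 - (m + 2)⁻¹`. -/
noncomputable def alpha (m : ℕ) : ℝ := 1 - ((m : ℝ) + 2)⁻¹

/-- The subproblem solution operator for the subspace `span {ω}`: the orthogonal projection
`T_ω` of `H` onto `span {ω}`, that is `⟪T_ω e, v⟫ = ⟪e, v⟫` for all `v ∈ span {ω}`. -/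
noncomputable def subproblem (ω : sphere (0 : H) 1) (e : H) : H :=
  (Submodule.span ℝ {(ω : H)}).starProjection e

/-- The step size `ξ_m`, in terms of `u`, the current iterate `x`, `α = α_m` and the residual
`r = r_{ω_m}^{(m)}`. It minimizes `ξ ↦ ‖u - α x - ξ r‖`, see `norm_sub_le_of_stepSize`
(if `r = 0`, every `ξ` is a minimizer, and `ξ r` does not depend on it). -/
noncomputable def stepSize (u x r : H) (α : ℝ) : ℝ :=
  (⟪u, r⟫ - α * ⟪x, r⟫) / ⟪r, r⟫

/-- The iterates `u^{(m)}` of the algorithm for the target `u` and the sequence of sampled unit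
vectors `ω_0, ω_1, …`. -/
noncomputable def iterate (u : H) (ω : ℕ → sphere (0 : H) 1) : ℕ → H
  | 0 => 0
  | m + 1 =>
    let x := iterate u ω m
    let r := subproblem (ω m) (u - x)
    alpha m • x + stepSize u x r (alpha m) • r

theorem norm_sub_le_of_stepSize (u x r : H) (α η : ℝ) :
    ‖u - (α • x + stepSize u x r α • r)‖ ≤ ‖u - (α • x + η • r)‖ := by
  rcases eq_or_ne r 0 with rfl | hr
  · simp
  have hrr : ⟪r, r⟫ ≠ 0 := inner_self_ne_zero.mpr hr
  have horth : ⟪u - (α • x + stepSize u x r α • r), r⟫ = 0 := by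
    rw [inner_sub_left, inner_add_left, inner_smul_left, inner_smul_left]
    simp only [stepSize, conj_trivial]
    field_simp
    ring
  have hdec : u - (α • x + η • r) =
      (u - (α • x + stepSize u x r α • r)) + (stepSize u x r α - η) • r := by
    module
  have h2 : ‖u - (α • x + η • r)‖ ^ 2 =
      ‖u - (α • x + stepSize u x r α • r)‖ ^ 2 + ‖(stepSize u x r α - η) • r‖ ^ 2 := by
    have := norm_add_sq_eq_norm_sq_add_norm_sq_of_inner_eq_zero
      (u - (α • x + stepSize u x r α • r)) ((stepSize u x r α - η) • r)
      (by rw [inner_smul_right, horth, mul_zero])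
    rw [hdec]; nlinarith [this]
  refine le_of_sq_le_sq ?_ (norm_nonneg _) |>.trans le_rfl
  rw [h2]
  nlinarith [sq_nonneg ‖(stepSize u x r α - η) • r‖]

/-- `ω_0, ω_1, …` are independent samples, each with distribution `ρ`. -/
structure IsIIDSample [MeasurableSpace H] (ρ : Measure (sphere (0 : H) 1))
    {Ω : Type*} [MeasurableSpace Ω] (P : Measure Ω) (ω : ℕ → Ω → sphere (0 : H) 1) : Prop where
  measurable : ∀ m, Measurable (ω m)
  map_eq : ∀ m, P.map (ω m) = ρ
  indep : iIndepFun ω P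

/-- The squared error `δ_m² = ‖u - u^{(m)}‖²` as a random variable. -/
noncomputable def sqError {Ω : Type*} (u : H) (ω : ℕ → Ω → sphere (0 : H) 1) (m : ℕ) (s : Ω) : ℝ :=
  ‖u - iterate u (fun k => ω k s) m‖ ^ 2

/-! ### The class `A₂` -/

/-- `v` represents `u`: `v` is a square integrable (in particular Bochner measurable) function
with `v ω ∈ span {ω}` for every `ω`, and `u = ∫ v dρ`. -/
def IsA2Rep [MeasurableSpace H] (ρ : Measure (sphere (0 : H) 1)) (u : H)
    (v : sphere (0 : H) 1 → H) : Prop :=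
  (∀ ω : sphere (0 : H) 1, v ω ∈ Submodule.span ℝ {(ω : H)}) ∧ MemLp v 2 ρ ∧ u = ∫ ω, v ω ∂ρ

/-- The class `A₂`. -/
def A2 [MeasurableSpace H] (ρ : Measure (sphere (0 : H) 1)) : Set H :=
  {u | ∃ v, IsA2Rep ρ u v}

/-- The norm of `A₂`: the infimum of `(∫ ‖v ω‖² dρ)^{1/2}` over all representations. -/
noncomputable def A2Norm [MeasurableSpace H] (ρ : Measure (sphere (0 : H) 1)) (u : H) : ℝ :=
  sInf {t | ∃ v, IsA2Rep ρ u v ∧ t = √(∫ ω, ‖v ω‖ ^ 2 ∂ρ)}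

/-! ### The spaces `H_L^s` for an orthonormal system `ψ` with weights `μ` -/

/-- `L^s(H) = {v = ∑ μ_k^s c_k ψ_k : ∑ c_k² < ∞}`. -/
def powSpace {ι : Type*} (ψ : ι → H) (μ : ι → ℝ) (s : ℝ) : Set H :=
  {v | ∃ c : ι → ℝ, Summable (fun k => c k ^ 2) ∧ HasSum (fun k => (μ k ^ s * c k) • ψ k) v}

/-- The coefficients `c_k` of `v = ∑ μ_k^s c_k ψ_k`, see `powCoeff_eq`. -/
noncomputable def powCoeff {ι : Type*} (ψ : ι → H) (μ : ι → ℝ) (s : ℝ) (v : H) (k : ι) : ℝ :=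
  μ k ^ (-s) * ⟪v, ψ k⟫

/-- The norm `(∑ c_k²)^{1/2}` of `v = ∑ μ_k^s c_k ψ_k`. -/
noncomputable def powNorm {ι : Type*} (ψ : ι → H) (μ : ι → ℝ) (s : ℝ) (v : H) : ℝ :=
  √(∑' k, powCoeff ψ μ s v k ^ 2)

theorem powCoeff_eq {ι : Type*} {ψ : ι → H} {μ : ι → ℝ} (hψ : Orthonormal ℝ ψ)
    (hμ : ∀ k, 0 < μ k) {s : ℝ} {v : H} {c : ι → ℝ}
    (hc : HasSum (fun k => (μ k ^ s * c k) • ψ k) v) : powCoeff ψ μ s v = c := by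
  classical
  funext k
  have h1 : HasSum (fun j => ⟪(μ j ^ s * c j) • ψ j, ψ k⟫) ⟪v, ψ k⟫ := by
    have := hc.mapL (innerSL ℝ (ψ k))
    simp only [innerSL_apply_apply] at this
    simpa only [real_inner_comm] using this
  have h2 : HasSum (fun j => ⟪(μ j ^ s * c j) • ψ j, ψ k⟫) (μ k ^ s * c k) := by
    convert hasSum_ite_eq k (μ k ^ s * c k) using 2 with j
    rw [inner_smul_left, orthonormal_iff_ite.mp hψ]
    by_cases hjk : j = k
    · subst hjk; simp
    · simp [hjk]
  rw [powCoeff, h1.unique h2, ← mul_assoc, ← Real.rpow_add (hμ k)]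
  simp

/-! ### The covariance operator -/

variable [MeasurableSpace H] [BorelSpace H] [SeparableSpace H]

theorem integrable_cov (ρ : Measure (sphere (0 : H) 1)) [IsProbabilityMeasure ρ] (v : H) :
    Integrable (fun ω : sphere (0 : H) 1 => ⟪v, (ω : H)⟫ • (ω : H)) ρ := by
  have : SecondCountableTopology H := UniformSpace.secondCountable_of_separable H
  have hc : Continuous (fun ω : sphere (0 : H) 1 => ⟪v, (ω : H)⟫ • (ω : H)) := by fun_prop
  refine Integrable.of_bound hc.aestronglyMeasurable ‖v‖ (ae_of_all _ fun ω => ?_)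
  have hω : ‖(ω : H)‖ = 1 := by simp
  rw [norm_smul, hω, mul_one]
  simpa [hω] using norm_inner_le_norm (𝕜 := ℝ) v (ω : H)

/-- The covariance operator `L v = ∫ ⟪v, ω⟫ ω dρ(ω)`. -/
noncomputable def covOp (ρ : Measure (sphere (0 : H) 1)) [IsProbabilityMeasure ρ] : H →L[ℝ] H :=
  LinearMap.mkContinuous
    { toFun := fun v => ∫ ω : sphere (0 : H) 1, ⟪v, (ω : H)⟫ • (ω : H) ∂ρ
      map_add' := fun v w => by
        simp only [inner_add_left, add_smul]
        exact integral_add (integrable_cov ρ v) (integrable_cov ρ w)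
      map_smul' := fun a v => by
        simp only [inner_smul_left, conj_trivial, mul_smul, RingHom.id_apply]
        exact integral_smul a _ }
    1 fun v => by
      have h : ∀ᵐ ω : sphere (0 : H) 1 ∂ρ, ‖⟪v, (ω : H)⟫ • (ω : H)‖ ≤ ‖v‖ :=
        ae_of_all _ fun ω => by
          have hω : ‖(ω : H)‖ = 1 := by simp
          rw [norm_smul, hω, mul_one]
          simpa [hω] using norm_inner_le_norm (𝕜 := ℝ) v (ω : H)
      simpa using norm_integral_le_of_norm_le_const h

/-- The subspace `H̃ = H ⊖ Ker L`. -/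
noncomputable def covSupport (ρ : Measure (sphere (0 : H) 1)) [IsProbabilityMeasure ρ] :
    Submodule ℝ H :=
  (LinearMap.ker (covOp ρ : H →ₗ[ℝ] H))ᗮ

/-- `ψ` is a complete orthonormal system for `H̃` of eigenvectors of `L`, with eigenvalues
`μ_k > 0`. Such a system always exists, see `exists_isCovEigenSystem`. -/
structure IsCovEigenSystem (ρ : Measure (sphere (0 : H) 1)) [IsProbabilityMeasure ρ]
    {ι : Type*} (ψ : ι → H) (μ : ι → ℝ) : Prop where
  orthonormal : Orthonormal ℝ ψ
  pos : ∀ k, 0 < μ k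
  eigen : ∀ k, covOp ρ (ψ k) = μ k • ψ k
  complete : (Submodule.span ℝ (Set.range ψ)).topologicalClosure = covSupport ρ

variable [CompleteSpace H]

theorem inner_covOp (ρ : Measure (sphere (0 : H) 1)) [IsProbabilityMeasure ρ] (v w : H) :
    ⟪covOp ρ v, w⟫ = ∫ ω : sphere (0 : H) 1, ⟪v, (ω : H)⟫ * ⟪w, (ω : H)⟫ ∂ρ := by
  have h := integral_inner (𝕜 := ℝ) (integrable_cov ρ v) w
  rw [real_inner_comm]
  change ⟪w, ∫ ω : sphere (0 : H) 1, ⟪v, (ω : H)⟫ • (ω : H) ∂ρ⟫ = _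
  rw [← h]
  simp only [inner_smul_right]

theorem isCompactOperator_covOp (ρ : Measure (sphere (0 : H) 1)) [IsProbabilityMeasure ρ] :
    IsCompactOperator (covOp ρ) := by
  have : SecondCountableTopology H := UniformSpace.secondCountable_of_separable H
  let R : sphere (0 : H) 1 → (H →L[ℝ] H) := fun ω => InnerProductSpace.rankOne ℝ (ω : H) (ω : H)
  have hR : Continuous R := by
    have h : R = fun ω : sphere (0 : H) 1 =>
        (ContinuousLinearMap.smulRightL ℝ H H (innerSL ℝ (ω : H))) (ω : H) := by
      funext ω; ext v; simp [R]
    rw [h]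
    fun_prop
  have hint : Integrable R ρ :=
    Integrable.of_bound hR.aestronglyMeasurable 1 (ae_of_all _ fun ω => by simp [R])
  have hL : covOp ρ = ∫ ω, R ω ∂ρ := by
    ext v
    rw [ContinuousLinearMap.integral_apply hint]
    change ∫ ω : sphere (0 : H) 1, ⟪v, (ω : H)⟫ • (ω : H) ∂ρ = _
    simp [R, real_inner_comm]
  have hmem : (∫ ω, R ω ∂ρ) ∈ (compactOperator (RingHom.id ℝ) H H : Set (H →L[ℝ] H)) := by
    refine Convex.integral_mem (Submodule.convex _) ?_ (ae_of_all _ fun ω => ?_) hint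
    · exact isClosed_setOfPred_isCompactOperator
    · change IsCompactOperator (R ω)
      have : (R ω : H → H) = (ContinuousLinearMap.toSpanSingleton ℝ (ω : H)) ∘ (innerSL ℝ (ω : H)) := by
        funext v; simp [R]
      rw [this]
      have h1 : IsCompactOperator (innerSL ℝ (ω : H)) :=
        isCompactOperator_of_locallyCompactSpace_dom (innerSL ℝ (ω : H))
      exact h1.clm_comp _
  rw [hL]
  exact hmem

/-- Eigensystems exist. -/
theorem exists_isCovEigenSystem.{u} {H : Type u} [NormedAddCommGroup H] [InnerProductSpace ℝ H]
    [CompleteSpace H] [SeparableSpace H] [MeasurableSpace H] [BorelSpace H]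
    (ρ : Measure (sphere (0 : H) 1)) [IsProbabilityMeasure ρ] :
    ∃ (ι : Type u) (ψ : ι → H) (μ : ι → ℝ), IsCovEigenSystem ρ ψ μ := by
  have hsymm : (covOp ρ : H →ₗ[ℝ] H).IsSymmetric := fun v w => by
    change ⟪covOp ρ v, w⟫ = ⟪v, covOp ρ w⟫
    rw [real_inner_comm (covOp ρ w) v, inner_covOp, inner_covOp]
    simp only [mul_comm]
  set T : Module.End ℝ H := (covOp ρ : H →ₗ[ℝ] H) with hT
  have hspec : (⨆ t, Module.End.eigenspace T t)ᗮ = ⊥ :=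
    ContinuousLinearMap.orthogonalComplement_iSup_eigenspaces_eq_bot
      (isCompactOperator_covOp ρ) hsymm
  have hclosed : ∀ t, IsClosed (Module.End.eigenspace T t : Set H) := fun t => by
    have : (Module.End.eigenspace T t : Set H) = {x | covOp ρ x = t • x} := by
      ext x; simp [hT]
    rw [this]
    exact isClosed_eq (covOp ρ).continuous (continuous_const_smul t)
  have : ∀ t, CompleteSpace (Module.End.eigenspace T t) := fun t => (hclosed t).completeSpace_coe
  choose w b hb using fun t : {t : ℝ // 0 < t} =>
    exists_hilbertBasis ℝ (Module.End.eigenspace T t.1)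
  have hfam := hsymm.orthogonalFamily_eigenspaces.comp
    (Subtype.coe_injective : Function.Injective (Subtype.val : {t : ℝ // 0 < t} → ℝ))
  let ψ : (Σ t : {t : ℝ // 0 < t}, w t) → H := fun a => (b a.1 a.2 : H)
  have heig : ∀ a : (Σ t : {t : ℝ // 0 < t}, w t), covOp ρ (ψ a) = a.1.1 • ψ a := fun a =>
    Module.End.mem_eigenspace_iff.mp (b a.1 a.2).2
  have hinner : ∀ x y : H, ⟪covOp ρ x, y⟫ = ⟪x, covOp ρ y⟫ := fun x y => hsymm x y
  have horth : (Submodule.span ℝ (Set.range ψ))ᗮ = LinearMap.ker T := by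
    apply le_antisymm
    · intro x hx
      have hker : IsClosed (LinearMap.ker T : Set H) := by
        have : (LinearMap.ker T : Set H) = {x | covOp ρ x = 0} := by
          ext x; simp [hT]
        rw [this]
        exact isClosed_eq (covOp ρ).continuous continuous_const
      have : CompleteSpace (LinearMap.ker T) := hker.completeSpace_coe
      set p := (LinearMap.ker T).starProjection x with hp
      have hpk : p ∈ LinearMap.ker T := Submodule.starProjection_apply_mem _ _
      have hq : x - p ∈ (LinearMap.ker T)ᗮ := Submodule.sub_starProjection_mem_orthogonal x
      have hp0 : covOp ρ p = 0 := hpk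
      have hq0 : x - p ∈ (⨆ t, Module.End.eigenspace T t)ᗮ := by
        rw [← Submodule.iInf_orthogonal]
        refine (Submodule.mem_iInf _).mpr fun t => ?_
        rw [Submodule.mem_orthogonal]
        intro z hz
        have hz' : covOp ρ z = t • z := Module.End.mem_eigenspace_iff.mp hz
        rcases lt_trichotomy t 0 with ht | ht | ht
        · have h1 : 0 ≤ ⟪covOp ρ z, z⟫ := by
            rw [inner_covOp]
            exact integral_nonneg fun ω => mul_self_nonneg _
          rw [hz', inner_smul_left, conj_trivial] at h1
          have h2 : ⟪z, z⟫ ≤ 0 := by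
            by_contra hcon
            exact absurd h1 (not_le.mpr (mul_neg_of_neg_of_pos ht (not_le.mp hcon)))
          have : z = 0 := by
            rw [real_inner_self_eq_norm_sq] at h2
            exact norm_eq_zero.mp (pow_eq_zero_iff two_ne_zero |>.mp (le_antisymm h2 (sq_nonneg _)))
          simp [this]
        · subst ht
          have : z ∈ LinearMap.ker T := by
            change covOp ρ z = 0
            simpa using hz'
          exact (Submodule.mem_orthogonal _ _).mp hq z this
        · have hpz : ⟪z, p⟫ = 0 := by
            have h1 : ⟪covOp ρ z, p⟫ = 0 := by rw [hinner, hp0, inner_zero_right]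
            rw [hz', inner_smul_left, conj_trivial] at h1
            exact (mul_eq_zero.mp h1).resolve_left ht.ne'
          have hxz : ⟪z, x⟫ = 0 := by
            have hs := (b ⟨t, ht⟩).hasSum_repr ⟨z, hz⟩
            have hs2 := hs.mapL ((innerSL ℝ x).comp (Module.End.eigenspace T t).subtypeL)
            have h0 : ∀ i, ((innerSL ℝ x).comp (Module.End.eigenspace T t).subtypeL)
                (((b ⟨t, ht⟩).repr ⟨z, hz⟩ i) • (b ⟨t, ht⟩ i)) = 0 := fun i => by
              have hm : ⟪ψ ⟨⟨t, ht⟩, i⟩, x⟫ = 0 :=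
                (Submodule.mem_orthogonal _ _).mp hx _ (Submodule.subset_span ⟨_, rfl⟩)
              rw [map_smul]
              have : ((innerSL ℝ x).comp (Module.End.eigenspace T t).subtypeL) (b ⟨t, ht⟩ i)
                  = ⟪x, ψ ⟨⟨t, ht⟩, i⟩⟫ := rfl
              rw [this, real_inner_comm, hm, smul_zero]
            have h3 := hs2.unique (by simpa only [h0] using hasSum_zero)
            rw [real_inner_comm]
            exact h3
          rw [inner_sub_right, hxz, hpz, sub_zero]
      rw [hspec, Submodule.mem_bot, sub_eq_zero] at hq0
      rw [hq0]; exact hpk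
    · intro x hx
      have hx0 : covOp ρ x = 0 := hx
      rw [Submodule.mem_orthogonal]
      intro y hy
      induction hy using Submodule.span_induction with
      | mem y hy =>
        obtain ⟨a, rfl⟩ := hy
        have h1 : ⟪covOp ρ (ψ a), x⟫ = 0 := by rw [hinner, hx0, inner_zero_right]
        rw [heig, inner_smul_left, conj_trivial] at h1
        exact (mul_eq_zero.mp h1).resolve_left a.1.2.ne'
      | zero => simp
      | add y z _ _ hy hz => rw [inner_add_left, hy, hz, add_zero]
      | smul c y _ hy => rw [inner_smul_left, hy, mul_zero]
  refine ⟨_, ψ, fun a => a.1.1, ?_, fun a => a.1.2, heig, ?_⟩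
  · exact hfam.orthonormal_sigma_orthonormal fun t => (b t).orthonormal
  · rw [covSupport, ← Submodule.orthogonal_orthogonal_eq_closure, horth]

end

end RandomSubspace

open RandomSubspace

/-! Let A : H → L²(ρ) send v to ⟪v, ·⟫, and let S = A* be `synthesisOp`, so S g = ∫ g(ω) ω dρ and S
A = L. The functions e_k = μ_k^{-1/2} A ψ_k are orthonormal in L²(ρ) and ⟪ψ_k, S g⟫ = μ_k^{1/2}
⟪e_k, g⟫. By Bessel's inequality the range of S is H_L^{1/2}, and the least norm of a preimage is
the norm of that space. Since ω is a unit vector, representations in A₂ are just preimages under S.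

For the error, fix g, put b = S g and β = 1 - α_m, and compare the optimal step with the step β
g(ω_m) ω_m. Independence of ω_m from u^{(m)} replaces g(ω_m) ω_m by b in the cross term, which
yields the recursion `IsIIDSample.integral_sqError_succ_le`. A sample orthogonal to the error cannot
make the comparison step; this costs at most β² ‖u‖² on average. `sqrt_le_of_alpha_recursion` solves
the recursion. Taking b = u gives the rate on H_L^{1/2}, a general b the approximation bound, and
density of the span of ψ in H̃ the convergence. -/

namespace RandomSubspace

/-! ### Expansions in orthonormal systems -/

section Orthonormal

variable {E ι : Type*} [NormedAddCommGroup E] [InnerProductSpace ℝ E] {e : ι → E}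

theorem _root_.Orthonormal.summable_smul_of_summable_sq [CompleteSpace E] (he : Orthonormal ℝ e)
    {c : ι → ℝ} (hc : Summable fun k => c k ^ 2) : Summable fun k => c k • e k := by
  have h := (he.orthogonalFamily.summable_iff_norm_sq_summable c).mpr (by simpa using hc)
  simpa using h

theorem _root_.Orthonormal.inner_eq_of_hasSum (he : Orthonormal ℝ e) {c : ι → ℝ} {x : E}
    (hx : HasSum (fun k => c k • e k) x) (k : ι) : ⟪e k, x⟫ = c k := by
  classical
  have h := hx.mapL (innerSL ℝ (e k))
  simp only [innerSL_apply_apply, inner_smul_right, orthonormal_iff_ite.mp he, mul_ite, mul_one,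
    mul_zero, eq_comm (a := k)] at h
  simpa using h.unique (hasSum_single k fun b hb => if_neg hb)

theorem _root_.Orthonormal.hasSum_sq_of_hasSum (he : Orthonormal ℝ e) {c : ι → ℝ} {x : E}
    (hx : HasSum (fun k => c k • e k) x) : HasSum (fun k => c k ^ 2) (‖x‖ ^ 2) := by
  have h := hx.mapL (innerSL ℝ x)
  simpa only [innerSL_apply_apply, real_inner_self_eq_norm_sq, inner_smul_right,
    fun k => (real_inner_comm x (e k)).symm.trans (he.inner_eq_of_hasSum hx k), ← sq] using h

/-- Bessel's inequality makes the Fourier series converge to some y; then x - y lies both in Kᗮ and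
in Kᗮᗮ, hence vanishes. -/
theorem _root_.Orthonormal.hasSum_of_mem_closure_span [CompleteSpace E] (he : Orthonormal ℝ e)
    {x : E} (hx : x ∈ (Submodule.span ℝ (Set.range e)).topologicalClosure) :
    HasSum (fun k => ⟪e k, x⟫ • e k) x := by
  have hs : Summable fun k => ⟪e k, x⟫ ^ 2 := by simpa using he.inner_products_summable (x := x)
  obtain ⟨y, hy⟩ := he.summable_smul_of_summable_sq hs
  set K := Submodule.span ℝ (Set.range e)
  have hyK : y ∈ K.topologicalClosure :=
    K.isClosed_topologicalClosure.mem_of_tendsto hy <| .of_forall fun s =>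
      sum_mem fun k _ => K.le_topologicalClosure (K.smul_mem _ (Submodule.subset_span ⟨k, rfl⟩))
  have hperp : x - y ∈ Kᗮ := by
    rw [Submodule.mem_orthogonal]
    intro z hz
    induction hz using Submodule.span_induction with
    | mem z hz =>
      obtain ⟨k, rfl⟩ := hz
      rw [inner_sub_right, he.inner_eq_of_hasSum hy, sub_self]
    | zero => simp
    | add a b _ _ ha hb => rw [inner_add_left, ha, hb, add_zero]
    | smul a b _ hb => rw [inner_smul_left, hb, mul_zero]
  have hmem : x - y ∈ Kᗮᗮ := by
    rw [Submodule.orthogonal_orthogonal_eq_closure]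
    exact sub_mem hx hyK
  have h0 : ⟪x - y, x - y⟫ = 0 := (Submodule.mem_orthogonal _ _).mp hmem _ hperp
  rw [inner_self_eq_zero, sub_eq_zero] at h0
  rwa [h0] at hy ⊢

end Orthonormal

/-! ### Deterministic estimates: one step, and the scalar recursion -/

section Step

variable {H : Type*} [NormedAddCommGroup H] [InnerProductSpace ℝ H]

/-- One step of the iteration from the iterate `x` with the sampled vector `ω`. -/
noncomputable def nextIterate (u : H) (α : ℝ) (x : H) (ω : sphere (0 : H) 1) : H :=
  α • x + stepSize u x (subproblem ω (u - x)) α • subproblem ω (u - x)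

theorem iterate_succ (u : H) (ω : ℕ → sphere (0 : H) 1) (m : ℕ) :
    iterate u ω (m + 1) = nextIterate u (alpha m) (iterate u ω m) (ω m) := rfl

theorem subproblem_eq (ω : sphere (0 : H) 1) (e : H) :
    subproblem ω e = ⟪(ω : H), e⟫ • (ω : H) := by
  rw [subproblem, Submodule.starProjection_unit_singleton ℝ (by simp)]

theorem norm_sub_nextIterate_le (u x : H) (α : ℝ) (ω : sphere (0 : H) 1) :
    ‖u - nextIterate u α x ω‖ ≤ ‖u - α • x‖ := by
  simpa [nextIterate] using norm_sub_le_of_stepSize u x (subproblem ω (u - x)) α 0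

/-- The term `((1 - α) ⟪ω, u⟫)²` accounts for the samples orthogonal to the error `u - x`, for
which the search direction vanishes. -/
theorem norm_sub_nextIterate_sq_le (u x : H) (α t : ℝ) (ω : sphere (0 : H) 1) :
    ‖u - nextIterate u α x ω‖ ^ 2 ≤
      ‖u - α • x‖ ^ 2 - 2 * ⟪u - α • x, t • (ω : H)⟫ + t ^ 2
        + ((1 - α) * ⟪u, (ω : H)⟫) ^ 2 := by
  have hω : ‖(ω : H)‖ = 1 := by simp
  have hexp : ‖u - α • x - t • (ω : H)‖ ^ 2 =
      ‖u - α • x‖ ^ 2 - 2 * ⟪u - α • x, t • (ω : H)⟫ + t ^ 2 := by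
    rw [norm_sub_sq_real, norm_smul, hω, mul_one, Real.norm_eq_abs, sq_abs]
  by_cases h : ⟪(ω : H), u - x⟫ = 0
  · have h1 : nextIterate u α x ω = α • x := by simp [nextIterate, subproblem_eq, h]
    have h2 : ⟪u - α • x, t • (ω : H)⟫ = t * ((1 - α) * ⟪u, (ω : H)⟫) := by
      rw [real_inner_comm, inner_sub_left, sub_eq_zero] at h
      rw [inner_smul_right, inner_sub_left, inner_smul_left, conj_trivial, ← h]
      ring
    rw [h1, h2]
    -- With c = (1 - α) ⟪u, ω⟫ the terms beyond ‖u - α x‖² form t² - 2tc + c² = (t - c)².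
    nlinarith [sq_nonneg (t - (1 - α) * ⟪u, (ω : H)⟫)]
  -- This trial step size turns the residual into exactly t ω.
  · have h1 := norm_sub_le_of_stepSize u x (subproblem ω (u - x)) α (t / ⟪(ω : H), u - x⟫)
    have h3 : (t / ⟪(ω : H), u - x⟫) • subproblem ω (u - x) = t • (ω : H) := by
      rw [subproblem_eq, smul_smul, div_mul_cancel₀ t h]
    rw [h3, ← sub_sub u (α • x) (t • (ω : H))] at h1
    have h2 := pow_le_pow_left₀ (norm_nonneg _) h1 2
    rw [hexp] at h2
    exact h2.trans (le_add_of_nonneg_right (sq_nonneg _))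

theorem one_sub_alpha (m : ℕ) : 1 - alpha m = ((m : ℝ) + 2)⁻¹ := by simp [alpha]

theorem alpha_nonneg (m : ℕ) : 0 ≤ alpha m := by
  rw [alpha, sub_nonneg]
  exact inv_le_one_of_one_le₀ (by linarith [m.cast_nonneg (α := ℝ)])

theorem sub_alpha_smul (u x : H) (m : ℕ) :
    u - alpha m • x = alpha m • (u - x) + (1 - alpha m) • u := by module

/-- The trial step size 0 leaves the error α (u - x) + (1 - α) u, a convex combination of vectors of
norm at most ‖u‖. This uniform bound supplies all integrability of the errors. -/
theorem norm_sub_iterate_le (u : H) (ω : ℕ → sphere (0 : H) 1) (m : ℕ) :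
    ‖u - iterate u ω m‖ ≤ ‖u‖ := by
  induction m with
  | zero => simp [iterate]
  | succ m ih =>
    have h1 : 0 ≤ 1 - alpha m := by rw [one_sub_alpha]; positivity
    calc ‖u - iterate u ω (m + 1)‖ ≤ ‖u - alpha m • iterate u ω m‖ :=
          norm_sub_nextIterate_le _ _ _ _
      _ ≤ ‖alpha m • (u - iterate u ω m)‖ + ‖(1 - alpha m) • u‖ := by
          rw [sub_alpha_smul]; exact norm_add_le _ _
      _ = alpha m * ‖u - iterate u ω m‖ + (1 - alpha m) * ‖u‖ := by
          rw [norm_smul, norm_smul, Real.norm_of_nonneg (alpha_nonneg m), Real.norm_of_nonneg h1]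
      _ ≤ ‖u‖ := by nlinarith [alpha_nonneg m]

/-- Here d is the approximation error, which is averaged but never damped, and C drives the decay.
The choice of α_m makes the inductive bound reproduce itself: the C-part closes with equality, and
only the cross term loses something. -/
theorem sqrt_le_of_alpha_recursion {a : ℕ → ℝ} {C d : ℝ} (hd : 0 ≤ d)
    (h0 : a 0 ≤ C) (ha : ∀ m, 0 ≤ a m)
    (h : ∀ m, a (m + 1) ≤ (alpha m * √(a m) + (1 - alpha m) * d) ^ 2 + (1 - alpha m) ^ 2 * C)
    (m : ℕ) : √(a m) ≤ d + √C / √((m : ℝ) + 1) := by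
  have hC : 0 ≤ C := (ha 0).trans h0
  induction m with
  | zero => simpa using (Real.sqrt_le_sqrt h0).trans (le_add_of_nonneg_left hd)
  | succ m ih =>
    have hp : (0 : ℝ) < m + 1 := by positivity
    have hq : (0 : ℝ) < m + 2 := by positivity
    set p := √((m : ℝ) + 1) with hp'
    set q := √((m : ℝ) + 2) with hq'
    have hpp : p ^ 2 = m + 1 := Real.sq_sqrt hp.le
    have hqq : q ^ 2 = m + 2 := Real.sq_sqrt hq.le
    have hp0 : 0 < p := Real.sqrt_pos.mpr hp
    have hq0 : 0 < q := Real.sqrt_pos.mpr hq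
    have hpq : p ≤ q := Real.sqrt_le_sqrt (by linarith)
    have hcast : ((m + 1 : ℕ) : ℝ) + 1 = m + 2 := by push_cast; ring
    rw [hcast, ← hq']
    set s := √C with hs
    have hss : s ^ 2 = C := Real.sq_sqrt hC
    have hs0 : 0 ≤ s := Real.sqrt_nonneg _
    refine Real.sqrt_le_iff.mpr ⟨by positivity, (h m).trans ?_⟩
    have hα : alpha m = p ^ 2 / q ^ 2 := by
      rw [hpp, hqq, alpha]; field_simp; ring
    have hβ : 1 - alpha m = 1 / q ^ 2 := by rw [one_sub_alpha, hqq, one_div]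
    have hb : alpha m * √(a m) + (1 - alpha m) * d ≤ d + p * s / q ^ 2 := by
      calc alpha m * √(a m) + (1 - alpha m) * d
          ≤ alpha m * (d + s / p) + (1 - alpha m) * d := by
            gcongr; exact alpha_nonneg m
        _ = d + alpha m * (s / p) := by ring
        _ = d + p * s / q ^ 2 := by rw [hα]; field_simp
    have hnn : 0 ≤ alpha m * √(a m) + (1 - alpha m) * d := by
      rw [hβ]; exact add_nonneg (mul_nonneg (alpha_nonneg m) (Real.sqrt_nonneg _)) (by positivity)
    have h1 : p * s / q ^ 2 ≤ s / q := by
      rw [div_le_div_iff₀ (by positivity) hq0]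
      nlinarith [mul_nonneg hs0 hq0.le, mul_le_mul_of_nonneg_left hpq (mul_nonneg hs0 hq0.le)]
    -- This is p² + 1 = q², divided by q⁴ and multiplied by C.
    have h2 : (p * s / q ^ 2) ^ 2 + (1 / q ^ 2) ^ 2 * C = (s / q) ^ 2 := by
      rw [← hss]; field_simp
      rw [hpp, hqq]; ring
    rw [hβ] at hb hnn ⊢
    calc _ ≤ (d + p * s / q ^ 2) ^ 2 + (1 / q ^ 2) ^ 2 * C := by
          gcongr
      _ = d ^ 2 + 2 * d * (p * s / q ^ 2) + ((p * s / q ^ 2) ^ 2 + (1 / q ^ 2) ^ 2 * C) := by ring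
      _ ≤ d ^ 2 + 2 * d * (s / q) + (s / q) ^ 2 := by rw [h2]; gcongr
      _ = _ := by ring

end Step

/-! ### The factorization of L through L²(ρ), and the class A₂ -/

section Analysis

/-- Finite combinations have finitely many nonzero coefficients, so summability is free; this makes
`powSpace` dense in H̃. -/
theorem mem_powSpace_of_mem_span {H ι : Type*} [NormedAddCommGroup H] [InnerProductSpace ℝ H]
    {ψ : ι → H} {μ : ι → ℝ} (hμ : ∀ k, 0 < μ k) {s : ℝ} {v : H}
    (hv : v ∈ Submodule.span ℝ (Set.range ψ)) : v ∈ powSpace ψ μ s := by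
  obtain ⟨c, rfl⟩ := (Finsupp.mem_span_range_iff_exists_finsupp).mp hv
  have hzero : ∀ k ∉ c.support, c k = 0 := fun k hk => Finsupp.notMem_support_iff.mp hk
  refine ⟨fun k => μ k ^ (-s) * c k,
    summable_of_ne_finset_zero (s := c.support) fun k hk => by simp [hzero k hk], ?_⟩
  have h : ∀ k, μ k ^ s * (μ k ^ (-s) * c k) = c k := fun k => by
    rw [← mul_assoc, ← Real.rpow_add (hμ k)]; simp
  simp only [h]
  exact hasSum_sum_of_ne_finset_zero fun k hk => by simp [hzero k hk]

theorem _root_.MeasureTheory.Lp.norm_sq_eq_integral_sq {X : Type*} [MeasurableSpace X] {ν : Measure X}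
    (g : Lp ℝ 2 ν) :
    ‖g‖ ^ 2 = ∫ ω, g ω ^ 2 ∂ν := by
  rw [← real_inner_self_eq_norm_sq, L2.inner_def]
  simp [sq]

theorem integral_norm_smul_sphere_sq {H : Type*} [NormedAddCommGroup H] [InnerProductSpace ℝ H]
    [MeasurableSpace H] (ρ : Measure (sphere (0 : H) 1)) (g : Lp ℝ 2 ρ) :
    ∫ ω, ‖g ω • (ω : H)‖ ^ 2 ∂ρ = ‖g‖ ^ 2 := by
  simp [Lp.norm_sq_eq_integral_sq, norm_smul]


variable {H : Type*} [NormedAddCommGroup H] [InnerProductSpace ℝ H] [MeasurableSpace H]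
  [BorelSpace H] [SeparableSpace H]

theorem memLp_smul_sphere (ρ : Measure (sphere (0 : H) 1))
    {g : sphere (0 : H) 1 → ℝ} (hg : MemLp g 2 ρ) :
    MemLp (fun ω => g ω • (ω : H)) 2 ρ := by
  have : SecondCountableTopology H := UniformSpace.secondCountable_of_separable H
  refine hg.of_le (hg.aestronglyMeasurable.smul continuous_subtype_val.aestronglyMeasurable)
    (ae_of_all _ fun ω => ?_)
  simp [norm_smul]

theorem memLp_inner_sphere (ρ : Measure (sphere (0 : H) 1)) [IsProbabilityMeasure ρ] (v : H) :
    MemLp (fun ω : sphere (0 : H) 1 => ⟪v, (ω : H)⟫) 2 ρ := by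
  have : SecondCountableTopology H := UniformSpace.secondCountable_of_separable H
  have hc : Continuous (fun ω : sphere (0 : H) 1 => ⟪v, (ω : H)⟫) := by fun_prop
  refine MemLp.of_bound hc.aestronglyMeasurable ‖v‖ (ae_of_all _ fun ω => ?_)
  have hω : ‖(ω : H)‖ = 1 := by simp
  simpa [hω] using norm_inner_le_norm (𝕜 := ℝ) v (ω : H)

/-- The operator `H → L²(ρ)` that maps `v` to the function `ω ↦ ⟪v, ω⟫`. -/
noncomputable def analysisOp (ρ : Measure (sphere (0 : H) 1)) [IsProbabilityMeasure ρ] :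
    H →L[ℝ] Lp ℝ 2 ρ :=
  LinearMap.mkContinuous
    { toFun := fun v => (memLp_inner_sphere ρ v).toLp _
      map_add' := fun v w => by
        rw [← MemLp.toLp_add]
        congr 1
        funext ω
        exact inner_add_left _ _ _
      map_smul' := fun a v => by
        rw [RingHom.id_apply, ← MemLp.toLp_const_smul]
        congr 1
        funext ω
        simp [inner_smul_left] }
    1 fun v => by
      have h : ∀ᵐ ω ∂ρ, ‖(memLp_inner_sphere ρ v).toLp _ ω‖ ≤ ‖v‖ := by
        filter_upwards [(memLp_inner_sphere ρ v).coeFn_toLp] with ω hv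
        have hω : ‖(ω : H)‖ = 1 := by simp
        rw [hv]
        simpa [hω] using norm_inner_le_norm (𝕜 := ℝ) v (ω : H)
      simpa [measureUnivNNReal] using Lp.norm_le_of_ae_bound (norm_nonneg v) h

theorem coeFn_analysisOp (ρ : Measure (sphere (0 : H) 1)) [IsProbabilityMeasure ρ] (v : H) :
    analysisOp ρ v =ᵐ[ρ] fun ω => ⟪v, (ω : H)⟫ :=
  (memLp_inner_sphere ρ v).coeFn_toLp

theorem norm_analysisOp_le (ρ : Measure (sphere (0 : H) 1)) [IsProbabilityMeasure ρ] :
    ‖analysisOp ρ‖ ≤ 1 :=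
  LinearMap.mkContinuous_norm_le _ zero_le_one _

theorem integral_inner_sq_le (ρ : Measure (sphere (0 : H) 1)) [IsProbabilityMeasure ρ] (u : H) :
    ∫ ω : sphere (0 : H) 1, ⟪u, (ω : H)⟫ ^ 2 ∂ρ ≤ ‖u‖ ^ 2 := by
  have h : ‖analysisOp ρ u‖ ^ 2 = ∫ ω : sphere (0 : H) 1, ⟪u, (ω : H)⟫ ^ 2 ∂ρ := by
    rw [Lp.norm_sq_eq_integral_sq]
    refine integral_congr_ae ?_
    filter_upwards [coeFn_analysisOp ρ u] with ω h
    rw [h]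
  rw [← h]
  gcongr
  exact (analysisOp ρ).le_of_opNorm_le (norm_analysisOp_le ρ) u |>.trans_eq (one_mul _)

variable (ρ : Measure (sphere (0 : H) 1)) [IsProbabilityMeasure ρ]

variable [CompleteSpace H]

theorem inner_analysisOp (v w : H) :
    ⟪analysisOp ρ v, analysisOp ρ w⟫ = ⟪covOp ρ v, w⟫ := by
  rw [inner_covOp, L2.inner_def]
  refine integral_congr_ae ?_
  filter_upwards [coeFn_analysisOp ρ v, coeFn_analysisOp ρ w] with ω hv hw
  simp [hv, hw, mul_comm]

/-- The operator `L²(ρ) → H` that maps `g` to `∫ g(ω) ω dρ(ω)`, see `synthesisOp_eq_integral`. -/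
noncomputable def synthesisOp : Lp ℝ 2 ρ →L[ℝ] H :=
  ContinuousLinearMap.adjoint (analysisOp ρ)

theorem inner_synthesisOp (g : Lp ℝ 2 ρ) (v : H) :
    ⟪synthesisOp ρ g, v⟫ = ⟪g, analysisOp ρ v⟫ :=
  ContinuousLinearMap.adjoint_inner_left _ _ _

theorem norm_synthesisOp_le (g : Lp ℝ 2 ρ) : ‖synthesisOp ρ g‖ ≤ ‖g‖ := by
  have h : ‖synthesisOp ρ‖ ≤ 1 := by
    rw [synthesisOp, LinearIsometryEquiv.norm_map]
    exact norm_analysisOp_le ρ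
  exact (ContinuousLinearMap.le_of_opNorm_le _ h g).trans_eq (one_mul _)

theorem synthesisOp_eq_integral (g : Lp ℝ 2 ρ) :
    synthesisOp ρ g = ∫ ω, g ω • (ω : H) ∂ρ := by
  refine ext_inner_left ℝ fun v => ?_
  have hint : Integrable (fun ω => g ω • (ω : H)) ρ :=
    (memLp_smul_sphere ρ (Lp.memLp g)).integrable one_le_two
  rw [real_inner_comm, inner_synthesisOp, ← integral_inner hint, L2.inner_def]
  refine integral_congr_ae ?_
  filter_upwards [coeFn_analysisOp ρ v] with ω hv
  simp [hv, inner_smul_right, mul_comm]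

/-- Since ‖A z‖² = ⟪L z, z⟫, the kernel of L is killed by A, and so is orthogonal to the range of S
= A*. -/
theorem synthesisOp_mem_covSupport (g : Lp ℝ 2 ρ) : synthesisOp ρ g ∈ covSupport ρ := by
  rw [covSupport, Submodule.mem_orthogonal']
  intro z hz
  have hz0 : covOp ρ z = 0 := hz
  have h : ⟪analysisOp ρ z, analysisOp ρ z⟫ = 0 := by
    rw [inner_analysisOp, hz0, inner_zero_left]
  rw [inner_synthesisOp, inner_self_eq_zero.mp h, inner_zero_right]

section Representations

theorem isA2Rep_synthesisOp (g : Lp ℝ 2 ρ) :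
    IsA2Rep ρ (synthesisOp ρ g) fun ω => g ω • (ω : H) :=
  ⟨fun _ => Submodule.smul_mem _ _ (Submodule.mem_span_singleton_self _),
    memLp_smul_sphere ρ (Lp.memLp g), synthesisOp_eq_integral ρ g⟩

/-- Take g(ω) = ⟪ω, v ω⟫: as ω is a unit vector spanning the line of v ω, this gives g(ω) ω = v ω
and |g(ω)| = ‖v ω‖. -/
theorem IsA2Rep.exists_synthesisOp_eq {u : H} {v : sphere (0 : H) 1 → H} (h : IsA2Rep ρ u v) :
    ∃ g : Lp ℝ 2 ρ, synthesisOp ρ g = u ∧ ‖g‖ ^ 2 = ∫ ω, ‖v ω‖ ^ 2 ∂ρ := by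
  have : SecondCountableTopology H := UniformSpace.secondCountable_of_separable H
  obtain ⟨hspan, hmem, rfl⟩ := h
  have hv : ∀ ω, v ω = ⟪(ω : H), v ω⟫ • (ω : H) := fun ω => by
    obtain ⟨a, ha⟩ := Submodule.mem_span_singleton.mp (hspan ω)
    rw [← ha, inner_smul_right, real_inner_self_eq_norm_sq]
    simp
  have hg : MemLp (fun ω : sphere (0 : H) 1 => ⟪(ω : H), v ω⟫) 2 ρ := by
    refine hmem.of_le (continuous_subtype_val.aestronglyMeasurable.inner
      hmem.aestronglyMeasurable) (ae_of_all _ fun ω => ?_)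
    have hω : ‖(ω : H)‖ = 1 := by simp
    simpa [hω] using norm_inner_le_norm (𝕜 := ℝ) (ω : H) (v ω)
  have hae : ∀ᵐ ω ∂ρ, hg.toLp _ ω • (ω : H) = v ω := by
    filter_upwards [hg.coeFn_toLp] with ω h
    rw [h, ← hv]
  refine ⟨hg.toLp _, ?_, ?_⟩
  · rw [synthesisOp_eq_integral]
    exact integral_congr_ae hae
  · rw [← integral_norm_smul_sphere_sq]
    refine integral_congr_ae ?_
    filter_upwards [hae] with ω h
    rw [h]

theorem mem_A2_iff {u : H} : u ∈ A2 ρ ↔ u ∈ Set.range (synthesisOp ρ) :=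
  ⟨fun ⟨_, hv⟩ => let ⟨g, hg, _⟩ := hv.exists_synthesisOp_eq; ⟨g, hg⟩,
    fun ⟨g, hg⟩ => ⟨_, hg ▸ isA2Rep_synthesisOp ρ g⟩⟩

end Representations

section EigenSystem

variable {ρ} {ι : Type*} {ψ : ι → H} {μ : ι → ℝ}

theorem IsCovEigenSystem.orthonormal_analysisOp (hψ : IsCovEigenSystem ρ ψ μ) :
    Orthonormal ℝ fun k => (√(μ k))⁻¹ • analysisOp ρ (ψ k) := by
  classical
  rw [orthonormal_iff_ite]
  intro i j
  rw [inner_smul_left, inner_smul_right, inner_analysisOp, hψ.eigen, inner_smul_left,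
    orthonormal_iff_ite.mp hψ.orthonormal]
  have hi := Real.sqrt_pos.mpr (hψ.pos i)
  split_ifs with hij
  · subst hij
    have hs := Real.mul_self_sqrt (hψ.pos i).le
    simp only [conj_trivial]
    field_simp
    rw [sq, hs]
  · simp

/-- The coefficient of S g along ψ_k is ⟪A ψ_k, g⟫ = √μ_k ⟪e_k, g⟫, and nothing is missed because S
g lies in H̃. -/
theorem IsCovEigenSystem.hasSum_synthesisOp (hψ : IsCovEigenSystem ρ ψ μ) (g : Lp ℝ 2 ρ) :
    HasSum (fun k => (μ k ^ (1 / 2 : ℝ) * ⟪(√(μ k))⁻¹ • analysisOp ρ (ψ k), g⟫) • ψ k)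
      (synthesisOp ρ g) := by
  have hmem := synthesisOp_mem_covSupport ρ g
  rw [← hψ.complete] at hmem
  convert hψ.orthonormal.hasSum_of_mem_closure_span hmem using 3 with k
  rw [← Real.sqrt_eq_rpow, inner_smul_left, conj_trivial,
    mul_inv_cancel_left₀ (Real.sqrt_pos.mpr (hψ.pos k)).ne', real_inner_comm,
    ← inner_synthesisOp, real_inner_comm]

theorem IsCovEigenSystem.powNorm_synthesisOp_le (hψ : IsCovEigenSystem ρ ψ μ) (g : Lp ℝ 2 ρ) :
    powNorm ψ μ (1 / 2) (synthesisOp ρ g) ≤ ‖g‖ := by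
  rw [powNorm, powCoeff_eq hψ.orthonormal hψ.pos (hψ.hasSum_synthesisOp g)]
  refine Real.sqrt_le_iff.mpr ⟨norm_nonneg _, ?_⟩
  simpa using hψ.orthonormal_analysisOp.tsum_inner_products_le (x := g)

theorem IsCovEigenSystem.synthesisOp_mem_powSpace (hψ : IsCovEigenSystem ρ ψ μ) (g : Lp ℝ 2 ρ) :
    synthesisOp ρ g ∈ powSpace ψ μ (1 / 2) :=
  ⟨_, by simpa using hψ.orthonormal_analysisOp.inner_products_summable (x := g),
    hψ.hasSum_synthesisOp g⟩

/-- The preimage g = ∑ c_k e_k has no component orthogonal to the e_k, so Bessel's inequality is an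
equality for it. It therefore attains the infimum defining `A2Norm`. -/
theorem IsCovEigenSystem.exists_synthesisOp_eq (hψ : IsCovEigenSystem ρ ψ μ) {u : H}
    (hu : u ∈ powSpace ψ μ (1 / 2)) :
    ∃ g : Lp ℝ 2 ρ, synthesisOp ρ g = u ∧ ‖g‖ = powNorm ψ μ (1 / 2) u := by
  obtain ⟨c, hc, hsum⟩ := hu
  obtain ⟨g, hg⟩ := hψ.orthonormal_analysisOp.summable_smul_of_summable_sq hc
  refine ⟨g, ?_, ?_⟩
  · refine (hψ.hasSum_synthesisOp g).unique ?_
    simpa only [hψ.orthonormal_analysisOp.inner_eq_of_hasSum hg] using hsum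
  · rw [powNorm, powCoeff_eq hψ.orthonormal hψ.pos hsum,
      (hψ.orthonormal_analysisOp.hasSum_sq_of_hasSum hg).tsum_eq, Real.sqrt_sq (norm_nonneg _)]

theorem IsCovEigenSystem.A2_eq_powSpace (hψ : IsCovEigenSystem ρ ψ μ) :
    A2 ρ = powSpace ψ μ (1 / 2) := by
  ext u
  rw [mem_A2_iff]
  refine ⟨?_, fun hu => ?_⟩
  · rintro ⟨g, rfl⟩
    exact hψ.synthesisOp_mem_powSpace g
  · obtain ⟨g, hg, _⟩ := hψ.exists_synthesisOp_eq hu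
    exact ⟨g, hg⟩

theorem IsCovEigenSystem.A2Norm_eq_powNorm (hψ : IsCovEigenSystem ρ ψ μ) {u : H}
    (hu : u ∈ powSpace ψ μ (1 / 2)) : A2Norm ρ u = powNorm ψ μ (1 / 2) u := by
  obtain ⟨g, rfl, hg⟩ := hψ.exists_synthesisOp_eq hu
  refine IsLeast.csInf_eq ⟨⟨_, isA2Rep_synthesisOp ρ g, ?_⟩, ?_⟩
  · rw [integral_norm_smul_sphere_sq, Real.sqrt_sq (norm_nonneg _), hg]
  · rintro _ ⟨v, hv, rfl⟩
    obtain ⟨g', hg', hnorm⟩ := hv.exists_synthesisOp_eq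
    rw [← hnorm, Real.sqrt_sq (norm_nonneg _), ← hg']
    exact hψ.powNorm_synthesisOp_le g'

end EigenSystem
end Analysis

/-! ### Moment inequality and transfer of integrals to samples -/

section Sample

/-- After expanding the square only 𝔼 X ≤ (𝔼 X²)^{1/2} is needed, which is nonnegativity of the
variance. -/
theorem _root_.MeasureTheory.integral_add_const_sq_le {Ω : Type*} [MeasurableSpace Ω]
    {P : Measure Ω} [IsProbabilityMeasure P] {X : Ω → ℝ}
    (hX : MemLp X 2 P) {a b : ℝ} (ha : 0 ≤ a) (hb : 0 ≤ b) :
    ∫ s, (a * X s + b) ^ 2 ∂P ≤ (a * √(∫ s, X s ^ 2 ∂P) + b) ^ 2 := by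
  have h1 := hX.integrable one_le_two
  have h2 := hX.integrable_sq
  have hsq : √(∫ s, X s ^ 2 ∂P) ^ 2 = ∫ s, X s ^ 2 ∂P :=
    Real.sq_sqrt (integral_nonneg fun s => sq_nonneg _)
  have hle : ∫ s, X s ∂P ≤ √(∫ s, X s ^ 2 ∂P) := by
    refine Real.le_sqrt_of_sq_le ?_
    have := variance_nonneg X P
    rw [variance_eq_sub hX] at this
    simpa using this
  have hexp : ∀ s, (a * X s + b) ^ 2 = a ^ 2 * X s ^ 2 + 2 * a * b * X s + b ^ 2 := fun s => by
    ring
  simp only [hexp]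
  have i2 : Integrable (fun s => a ^ 2 * X s ^ 2) P := h2.const_mul _
  have i1 : Integrable (fun s => 2 * a * b * X s) P := h1.const_mul _
  have i21 : Integrable (fun s => a ^ 2 * X s ^ 2 + 2 * a * b * X s) P := i2.add i1
  rw [integral_add i21 (integrable_const _), integral_add i2 i1, integral_const_mul,
    integral_const_mul]
  simp only [integral_const, probReal_univ, one_smul]
  have := mul_le_mul_of_nonneg_left hle (by positivity : 0 ≤ 2 * a * b)
  nlinarith

variable {H : Type*} [NormedAddCommGroup H] {Ω : Type*} [MeasurableSpace Ω] {P : Measure Ω}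
  {ω : ℕ → Ω → sphere (0 : H) 1}

theorem integral_sqError_zero [InnerProductSpace ℝ H] [IsProbabilityMeasure P] (u : H) : ∫ s, sqError u ω 0 s ∂P = ‖u‖ ^ 2 := by
  simp [sqError, iterate]

theorem integral_sqError_nonneg [InnerProductSpace ℝ H] (u : H) (m : ℕ) : 0 ≤ ∫ s, sqError u ω m s ∂P :=
  integral_nonneg fun _ => sq_nonneg _

variable [MeasurableSpace H] {ρ : Measure (sphere (0 : H) 1)}

theorem IsIIDSample.integral_comp (h : IsIIDSample ρ P ω) {f : sphere (0 : H) 1 → ℝ}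
    (hf : AEStronglyMeasurable f ρ) (m : ℕ) : ∫ s, f (ω m s) ∂P = ∫ x, f x ∂ρ := by
  rw [← h.map_eq m] at hf ⊢
  rw [integral_map (h.measurable m).aemeasurable hf]

theorem IsIIDSample.integrable_comp (h : IsIIDSample ρ P ω) {E : Type*} [NormedAddCommGroup E]
    {f : sphere (0 : H) 1 → E} (hf : Integrable f ρ) (m : ℕ) :
    Integrable (fun s => f (ω m s)) P := by
  rw [← h.map_eq m] at hf
  exact hf.comp_measurable (h.measurable m)

end Sample

/-! ### Independence and the recursion for the mean squared error -/

section Random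

variable {H : Type*} [NormedAddCommGroup H] [InnerProductSpace ℝ H] [MeasurableSpace H]
  [BorelSpace H] [SeparableSpace H]

theorem measurable_nextIterate (u : H) (α : ℝ) {X : Type*} [MeasurableSpace X] {f : X → H}
    {g : X → sphere (0 : H) 1} (hf : Measurable f) (hg : Measurable g) :
    Measurable fun y => nextIterate u α (f y) (g y) := by
  have : SecondCountableTopology H := UniformSpace.secondCountable_of_separable H
  have hg' : Measurable fun y => (g y : H) := measurable_subtype_coe.comp hg
  have hr : Measurable fun y => subproblem (g y) (u - f y) := by
    simp only [subproblem_eq]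
    exact (hg'.inner (hf.const_sub u)).smul hg'
  exact (hf.const_smul α).add ((((measurable_const.inner hr).sub
    ((hf.inner hr).const_mul α)).div (hr.inner hr)).smul hr)

/-- The m-th iterate uses only the samples with index below m. This yields both its measurability
and its independence from ω_m. -/
theorem exists_measurable_iterate_eq (u : H) (m : ℕ) :
    ∃ F : (Finset.range m → sphere (0 : H) 1) → H, Measurable F ∧
      ∀ w : ℕ → sphere (0 : H) 1, iterate u w m = F fun i => w i := by
  induction m with
  | zero => exact ⟨fun _ => 0, measurable_const, fun _ => rfl⟩
  | succ m ih =>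
    obtain ⟨F, hF, hFw⟩ := ih
    refine ⟨fun y => nextIterate u (alpha m)
      (F fun i => y ⟨i, Finset.range_subset_range.mpr m.le_succ i.2⟩)
      (y ⟨m, Finset.self_mem_range_succ m⟩), ?_, fun w => ?_⟩
    · exact measurable_nextIterate u _
        (hF.comp (measurable_pi_lambda _ fun i => measurable_pi_apply _)) (measurable_pi_apply _)
    · rw [iterate_succ, hFw]

variable {ρ : Measure (sphere (0 : H) 1)} {Ω : Type*} [MeasurableSpace Ω] {P : Measure Ω}
  {ω : ℕ → Ω → sphere (0 : H) 1}

theorem IsIIDSample.measurable_iterate (h : IsIIDSample ρ P ω) (u : H) (m : ℕ) :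
    Measurable fun s => iterate u (fun k => ω k s) m := by
  obtain ⟨F, hF, hFw⟩ := exists_measurable_iterate_eq u m
  simp only [hFw]
  exact hF.comp (measurable_pi_lambda _ fun i => h.measurable i)

theorem IsIIDSample.indepFun_iterate (h : IsIIDSample ρ P ω) (u : H) (m : ℕ) :
    IndepFun (fun s => iterate u (fun k => ω k s) m) (ω m) P := by
  obtain ⟨F, hF, hFw⟩ := exists_measurable_iterate_eq u m
  simp only [hFw]
  exact (h.indep.indepFun_finset (Finset.range m) {m} (by simp) h.measurable).comp hF
    (measurable_pi_apply (⟨m, Finset.mem_singleton_self m⟩ : ({m} : Finset ℕ)))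

theorem IsIIDSample.memLp_sub_iterate [IsFiniteMeasure P] (h : IsIIDSample ρ P ω) (u : H)
    (m : ℕ) : MemLp (fun s => u - iterate u (fun k => ω k s) m) 2 P := by
  have : SecondCountableTopology H := UniformSpace.secondCountable_of_separable H
  exact MemLp.of_bound ((h.measurable_iterate u m).const_sub u).aestronglyMeasurable ‖u‖
    (ae_of_all _ fun s => norm_sub_iterate_le u _ m)

theorem IsIIDSample.integrable_sqError [IsFiniteMeasure P] (h : IsIIDSample ρ P ω) (u : H)
    (m : ℕ) : Integrable (sqError u ω m) P :=
  (h.memLp_sub_iterate u m).integrable_norm_pow two_ne_zero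

variable [CompleteSpace H] [IsProbabilityMeasure ρ] [IsProbabilityMeasure P]

/-- The term -‖S g‖² comes from completing the square around β b. It is kept because it cancels ‖u‖²
exactly when S g = u. -/
theorem IsIIDSample.integral_sqError_succ_le (h : IsIIDSample ρ P ω) (u : H) (g : Lp ℝ 2 ρ)
    (m : ℕ) :
    ∫ s, sqError u ω (m + 1) s ∂P ≤
      (alpha m * √(∫ s, sqError u ω m s ∂P) + (1 - alpha m) * ‖u - synthesisOp ρ g‖) ^ 2
        + (1 - alpha m) ^ 2 * (‖g‖ ^ 2 + ‖u‖ ^ 2 - ‖synthesisOp ρ g‖ ^ 2) := by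
  have : SecondCountableTopology H := UniformSpace.secondCountable_of_separable H
  set α := alpha m
  set β := 1 - α with hβ
  have hα0 : 0 ≤ α := alpha_nonneg m
  have hβ0 : 0 ≤ β := by rw [hβ, one_sub_alpha]; positivity
  set b := synthesisOp ρ g
  let x : Ω → H := fun s => iterate u (fun k => ω k s) m
  let w : Ω → H := fun s => u - α • x s
  let v : sphere (0 : H) 1 → H := fun y => g y • (y : H)
  have hv : Integrable v ρ := (memLp_smul_sphere ρ (Lp.memLp g)).integrable one_le_two
  have hw_eq : ∀ s, w s = α • (u - x s) + β • u := fun s => sub_alpha_smul u (x s) m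
  have hw : MemLp w 2 P := by
    rw [funext hw_eq]
    exact ((h.memLp_sub_iterate u m).const_smul α).add (memLp_const _)
  have hw1 : Integrable w P := hw.integrable one_le_two
  have hv_meas : Measurable v :=
    (Lp.stronglyMeasurable g).measurable.smul measurable_subtype_coe
  have hvω : Integrable (fun s => v (ω m s)) P := h.integrable_comp hv m
  have hg2 : Integrable (fun y => g y ^ 2) ρ := (Lp.memLp g).integrable_sq
  have hu2 : Integrable (fun y : sphere (0 : H) 1 => ⟪u, (y : H)⟫ ^ 2) ρ :=
    (memLp_inner_sphere ρ u).integrable_sq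
  have hx : Measurable x := h.measurable_iterate u m
  have hstep : Measurable fun z : H => u - α • z := (measurable_id.const_smul α).const_sub u
  have hind : IndepFun x (ω m) P := h.indepFun_iterate u m
  -- By independence the mean of the inner product is the inner product of the means, and the mean
  -- of v(ω_m) is S g = b.
  have hcross : ∫ s, ⟪w s, v (ω m s)⟫ ∂P = ∫ s, ⟪w s, b⟫ ∂P := by
    have h1 : ∫ s, ⟪w s, v (ω m s)⟫ ∂P = ⟪∫ s, w s ∂P, ∫ s, v (ω m s) ∂P⟫ :=
      hind.integral_bilin_comp_comp (𝕜 := ℝ) (f := fun z => u - α • z) (g := v)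
        hx.aemeasurable (h.measurable m).aemeasurable
        ((integrable_map_measure hstep.aestronglyMeasurable hx.aemeasurable).mpr hw1)
        (by rw [h.map_eq m]; exact hv) (innerSL ℝ)
    refine h1.trans ?_
    have h2 : ∫ s, v (ω m s) ∂P = b := by
      rw [← integral_map (h.measurable m).aemeasurable
        (by rw [h.map_eq m]; exact hv.aestronglyMeasurable), h.map_eq m]
      exact (synthesisOp_eq_integral ρ g).symm
    rw [h2]
    simp only [real_inner_comm b]
    exact (integral_inner hw1 b).symm
  have hcross_int : Integrable (fun s => ⟪w s, v (ω m s)⟫) P :=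
    (hind.comp hstep hv_meas).integrable_bilin (𝕜 := ℝ) hw1 hvω (innerSL ℝ)
  have hwb_int : Integrable (fun s => ⟪w s, b⟫) P := hw1.inner_const b
  have hw2 : Integrable (fun s => ‖w s‖ ^ 2) P := hw.integrable_norm_pow two_ne_zero
  -- The comparison step is t = β g(ω_m).
  have hpoint : ∀ s, sqError u ω (m + 1) s ≤ ‖w s‖ ^ 2 - 2 * β * ⟪w s, v (ω m s)⟫
      + β ^ 2 * g (ω m s) ^ 2 + β ^ 2 * ⟪u, (ω m s : H)⟫ ^ 2 := fun s => by
    refine (norm_sub_nextIterate_sq_le u (x s) α (β * g (ω m s)) (ω m s)).trans_eq ?_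
    rw [mul_smul, inner_smul_right, mul_pow, mul_pow, mul_assoc]
  have i1 : Integrable (fun s => ‖w s‖ ^ 2 - 2 * β * ⟪w s, v (ω m s)⟫) P :=
    hw2.sub (hcross_int.const_mul _)
  have i2 : Integrable (fun s => β ^ 2 * g (ω m s) ^ 2) P :=
    (h.integrable_comp hg2 m).const_mul _
  have i3 : Integrable (fun s => β ^ 2 * ⟪u, (ω m s : H)⟫ ^ 2) P :=
    (h.integrable_comp hu2 m).const_mul _
  have i12 : Integrable (fun s => ‖w s‖ ^ 2 - 2 * β * ⟪w s, v (ω m s)⟫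
      + β ^ 2 * g (ω m s) ^ 2) P := i1.add i2
  have hmean := integral_mono (h.integrable_sqError u (m + 1)) (i12.add i3) hpoint
  simp only [Pi.add_apply] at hmean
  rw [integral_add i12 i3, integral_add i1 i2,
    integral_sub hw2 (hcross_int.const_mul _), integral_const_mul, integral_const_mul,
    integral_const_mul, h.integral_comp hg2.aestronglyMeasurable m,
    h.integral_comp hu2.aestronglyMeasurable m, hcross, ← Lp.norm_sq_eq_integral_sq] at hmean
  have hsub : ∫ s, ‖w s - β • b‖ ^ 2 ∂P =
      ∫ s, ‖w s‖ ^ 2 ∂P - 2 * β * ∫ s, ⟪w s, b⟫ ∂P + β ^ 2 * ‖b‖ ^ 2 := by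
    have hexp : ∀ s, ‖w s - β • b‖ ^ 2 =
        ‖w s‖ ^ 2 - 2 * β * ⟪w s, b⟫ + β ^ 2 * ‖b‖ ^ 2 := fun s => by
      rw [norm_sub_sq_real, inner_smul_right, norm_smul, mul_pow, Real.norm_eq_abs, sq_abs,
        mul_assoc]
    simp only [hexp]
    have i : Integrable (fun s => ‖w s‖ ^ 2 - 2 * β * ⟪w s, b⟫) P :=
      hw2.sub (hwb_int.const_mul _)
    rw [integral_add i (integrable_const _),
      integral_sub hw2 (hwb_int.const_mul _), integral_const_mul]
    simp
  -- The identity behind this is w - β b = α (u - x) + β (u - b).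
  have hnorm : ∀ s, ‖w s - β • b‖ ≤ α * ‖u - x s‖ + β * ‖u - b‖ := fun s => by
    rw [hw_eq, add_sub_assoc, ← smul_sub]
    refine (norm_add_le _ _).trans_eq ?_
    rw [norm_smul, norm_smul, Real.norm_of_nonneg hα0, Real.norm_of_nonneg hβ0]
  have herr : MemLp (fun s => ‖u - x s‖) 2 P := (h.memLp_sub_iterate u m).norm
  have hbound : ∫ s, ‖w s - β • b‖ ^ 2 ∂P ≤
      (α * √(∫ s, sqError u ω m s ∂P) + β * ‖u - b‖) ^ 2 := by
    refine le_trans (integral_mono ?_ ?_ fun s => pow_le_pow_left₀ (norm_nonneg _) (hnorm s) 2)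
      (integral_add_const_sq_le herr hα0 (mul_nonneg hβ0 (norm_nonneg (u - b))))
    · exact (hw.sub (memLp_const (β • b))).integrable_norm_pow two_ne_zero
    · exact ((herr.const_mul α).add (memLp_const _)).integrable_sq
  have hmul := mul_le_mul_of_nonneg_left (integral_inner_sq_le ρ u) (sq_nonneg β)
  linarith

end Random

/-! ### Rates and convergence -/

section Convergence

variable {H : Type*} [NormedAddCommGroup H] [InnerProductSpace ℝ H] [MeasurableSpace H]
  [BorelSpace H] [SeparableSpace H] [CompleteSpace H]
  {ρ : Measure (sphere (0 : H) 1)} [IsProbabilityMeasure ρ] {Ω : Type*} [MeasurableSpace Ω]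
  {P : Measure Ω} [IsProbabilityMeasure P] {ω : ℕ → Ω → sphere (0 : H) 1}
  {ι : Type*} {ψ : ι → H} {μ : ι → ℝ}

theorem IsIIDSample.integral_sqError_le (h : IsIIDSample ρ P ω) (hψ : IsCovEigenSystem ρ ψ μ)
    {u : H} (hu : u ∈ powSpace ψ μ (1 / 2)) (m : ℕ) :
    ∫ s, sqError u ω m s ∂P ≤ powNorm ψ μ (1 / 2) u ^ 2 / ((m : ℝ) + 1) := by
  obtain ⟨g, hgu, hg⟩ := hψ.exists_synthesisOp_eq hu
  rw [← hg]
  have hle : ‖u‖ ^ 2 ≤ ‖g‖ ^ 2 := by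
    gcongr
    rw [← hgu]
    exact norm_synthesisOp_le ρ g
  have hm : (0 : ℝ) ≤ m + 1 := by positivity
  -- For S g = u there is no approximation error, and ‖u‖² cancels against ‖S g‖², leaving C = ‖g‖².
  -- The initial condition is ‖u‖ ≤ ‖g‖.
  have hrec := sqrt_le_of_alpha_recursion (a := fun m => ∫ s, sqError u ω m s ∂P)
    (C := ‖g‖ ^ 2) (d := 0) le_rfl (by rw [integral_sqError_zero]; exact hle)
    (integral_sqError_nonneg u) (fun m => by
      simpa [hgu] using h.integral_sqError_succ_le u g m) m
  rw [zero_add, ← Real.sqrt_div (sq_nonneg _)] at hrec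
  exact (Real.sqrt_le_sqrt_iff (by positivity)).mp hrec

theorem IsIIDSample.sqrt_integral_sqError_le (h : IsIIDSample ρ P ω)
    (hψ : IsCovEigenSystem ρ ψ μ) (u : H) {b : H} (hb : b ∈ powSpace ψ μ (1 / 2)) (m : ℕ) :
    √(∫ s, sqError u ω m s ∂P) ≤
      ‖u - b‖ + √(powNorm ψ μ (1 / 2) b ^ 2 + ‖u‖ ^ 2) / √((m : ℝ) + 1) := by
  obtain ⟨g, rfl, hg⟩ := hψ.exists_synthesisOp_eq hb
  rw [← hg]
  refine sqrt_le_of_alpha_recursion (a := fun m => ∫ s, sqError u ω m s ∂P) (norm_nonneg _)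
    (by rw [integral_sqError_zero]; exact le_add_of_nonneg_left (sq_nonneg _))
    (integral_sqError_nonneg u) (fun m => ?_) m
  refine (h.integral_sqError_succ_le u g m).trans ?_
  gcongr
  exact sub_le_self _ (sq_nonneg _)

theorem IsIIDSample.tendsto_integral_sqError (h : IsIIDSample ρ P ω)
    (hψ : IsCovEigenSystem ρ ψ μ) {u : H} (hu : u ∈ covSupport ρ) :
    Tendsto (fun m => ∫ s, sqError u ω m s ∂P) atTop (𝓝 0) := by
  suffices hs : Tendsto (fun m => √(∫ s, sqError u ω m s ∂P)) atTop (𝓝 0) by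
    simpa [Real.sq_sqrt (integral_sqError_nonneg u _)] using hs.pow 2
  have hcl : u ∈ closure (Submodule.span ℝ (Set.range ψ) : Set H) := by
    rw [← hψ.complete] at hu
    exact hu
  have hm : Tendsto (fun m : ℕ => √((m : ℝ) + 1)) atTop atTop :=
    Real.tendsto_sqrt_atTop.comp
      (tendsto_atTop_add_const_right _ _ tendsto_natCast_atTop_atTop)
  refine tendsto_order.mpr ⟨fun a ha => .of_forall fun m => ha.trans_le (Real.sqrt_nonneg _),
    fun ε hε => ?_⟩
  -- The bound for this b tends to ‖u - b‖ < ε, so it is eventually below ε.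
  obtain ⟨b, hb, hub⟩ := Metric.mem_closure_iff.mp hcl ε hε
  rw [dist_eq_norm] at hub
  have hlim : Tendsto (fun m : ℕ =>
      ‖u - b‖ + √(powNorm ψ μ (1 / 2) b ^ 2 + ‖u‖ ^ 2) / √((m : ℝ) + 1)) atTop
      (𝓝 ‖u - b‖) := by
    simpa using (tendsto_const_nhds (x := ‖u - b‖)).add (hm.const_div_atTop _)
  filter_upwards [hlim.eventually_lt_const hub] with m hm
  exact (h.sqrt_integral_sqError_le hψ u (mem_powSpace_of_mem_span hψ.pos hb) m).trans_lt hm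

end Convergence

end RandomSubspace

theorem theorem3 {H : Type*} [NormedAddCommGroup H] [InnerProductSpace ℝ H] [CompleteSpace H]
    [SeparableSpace H] [MeasurableSpace H] [BorelSpace H]
    (ρ : Measure (sphere (0 : H) 1)) [IsProbabilityMeasure ρ]
    {ι : Type*} (ψ : ι → H) (μ : ι → ℝ) (hψ : IsCovEigenSystem ρ ψ μ) :
    (∀ (Ω : Type*) [MeasurableSpace Ω] (P : Measure Ω) [IsProbabilityMeasure P]
        (ω : ℕ → Ω → sphere (0 : H) 1), IsIIDSample ρ P ω →
      (∀ (u : H) (m : ℕ), Integrable (sqError u ω m) P) ∧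
      (∀ u ∈ powSpace ψ μ (1 / 2), ∀ m : ℕ,
        ∫ s, sqError u ω m s ∂P ≤ powNorm ψ μ (1 / 2) u ^ 2 / ((m : ℝ) + 1)) ∧
      (∀ u : H, ∀ h ∈ powSpace ψ μ (1 / 2), ∀ m : ℕ,
        √(∫ s, sqError u ω m s ∂P) ≤
          2 * (‖u - h‖ + √(powNorm ψ μ (1 / 2) h ^ 2 + ‖u‖ ^ 2) / √((m : ℝ) + 1))) ∧
      (∀ u ∈ covSupport ρ, Tendsto (fun m => ∫ s, sqError u ω m s ∂P) atTop (𝓝 0))) ∧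
    (A2 ρ = powSpace ψ μ (1 / 2) ∧
      ∀ u ∈ powSpace ψ μ (1 / 2), A2Norm ρ u = powNorm ψ μ (1 / 2) u) := by
  refine ⟨fun Ω _ P _ ω h => ⟨h.integrable_sqError, fun u hu => h.integral_sqError_le hψ hu,
    fun u b hb m => ?_, fun u hu => h.tendsto_integral_sqError hψ hu⟩,
    hψ.A2_eq_powSpace, fun u hu => hψ.A2Norm_eq_powNorm hu⟩
  have := h.sqrt_integral_sqError_le hψ u hb m
  -- The estimate already holds without the factor 2.
  exact this.trans (le_mul_of_one_le_left (by positivity) one_le_two)
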